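/- Let $X,Y,Z$ be (real) locally convex Hausdorff topological vector spaces. Let $K\subsetneq Y$ be a closed convex cone with $\operatorname{int}K\neq\emptyset$, let $S\subset Z$ be a nonempty closed convex cone, and let $\mathcal U$ be a nonempty set. Put $Y^\bullet=Y\cup\{-\infty_Y,+\infty_Y\}$, $Z^\bullet=Z\cup\{-\infty_Z,+\infty_Z\}$. Let $F\colon X\to Y^\bullet$ and $G_u\colon X\to Z^\bullet$ $(u\in\mathcal U)$ be proper (never $-\infty$, not identically $+\infty$), let $C\subset X$, and put $$A=C\cap\bigcap_{u\in\mathcal U}G_u^{-1}(-S),\qquad \operatorname{dom}F=\{x\in X: F(x)\neq+\infty_Y\},\qquad A\cap\operatorname{dom}F\neq\emptyset .$$ Notation. For $D\subset X$, $I_D\colon X\to Y^\bullet$ is $0_Y$ on $D$ and $+\infty_Y$ off $D$. $\mathcal L(X,Y)$ is the space of continuous linear mappings with the topology of pointwise convergence, and $\mathcal L(X,Y)\times Y$ has the product topology. $K^+=\{y^*\in Y^*: y^*(y)\ge 0\ \forall y\in K\}$, and $S^+\subset Z^*$ is defined likewise. Write $y_1<_K y_2$ if $y_1-y_2\in-\operatorname{int}K$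 $(y_1,y_2\in Y)$, and $-\infty_Y<_K y<_K+\infty_Y$ for $y\in Y$. For $M\subset Y^\bullet$, $\operatorname{WSup}M$ is the set of $\bar v\in Y^\bullet$ such that $\bar v\not<_K v$ for all $v\in M$ and, for every $\tilde v\in Y^\bullet$ with $\tilde v<_K\bar v$, some $v\in M$ satisfies $\tilde v<_K v$. For a proper mapping $H\colon X\to Y^\bullet$, $$H^*(L)=\operatorname{WSup}\{L(x)-H(x):x\in X\},\qquad \operatorname{epi}H^*=\{(L,y)\in\mathcal L(X,Y)\times Y: y\in H^*(L)+K\}.$$ For $k\in Y$ and a continuous linear functional $w^*$ on $W$ ($W=X$ or $W=Z$), $k\cdot w^*$ is the mapping $w\mapsto\langle w^*,w\rangle k$ from $W$ to $Y$, and $((k\cdot z^*)\circ G_u)(x)=+\infty_Y$ where $G_u(x)=+\infty_Z$. Let $E_k=\{(k\cdot x^*,rk):x^*\in X^*,\ r\in\mathbb R\}$. A set $N\subset\mathcal L(X,Y)\times Y$ is $k$-sectionally convex if $N\cap(E_k+v)$ is convex for every $v\in\mathcal L(X,Y)\times Y$, and $\operatorname{sco}_kN$ is the intersection of all $k$-sectionally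 convex sets containing $N$. Finally $$\mathcal A_k=\bigcup_{(z^*,u)\in S^+\times\mathcal U}\operatorname{epi}\bigl(F+I_C+(k\cdot z^*)\circ G_u\bigr)^*.$$ **Theorem 4.1.** Assume $(\mathcal H_0)$: $F$ is $K$-convex ($\{(x,y)\in X\times Y: y\in F(x)+K\}$ is convex) and positively $K$-lsc ($y^*\circ F$ is lower semicontinuous for every $y^*\in K^+\setminus\{0\}$); for every $u\in\mathcal U$, $G_u$ is $S$-convex and $S$-epi-closed ($\{(x,z)\in X\times Z: z\in G_u(x)+S\}$ is convex and closed); and $C$ is nonempty, closed and convex. Then, for every $k\in\operatorname{int}K$, $$\operatorname{epi}(F+I_A)^*=\operatorname{cl}\bigl(\operatorname{sco}_k\mathcal A_k\bigr).$$ -/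

import Mathlib

open scoped Pointwise

noncomputable section

namespace RVP

/-! ### The extended space `Y ∪ {-∞_Y, +∞_Y}` -/

/-- `Y` with a smallest element `⊥ = -∞_Y` and a greatest element `⊤ = +∞_Y` attached.
`Ext ℝ` is `EReal`. Addition is the one of Mathlib: `⊤ + y = ⊤` for `y ≠ ⊥` and `⊥ + y = ⊥`
for `y ≠ ⊤`. (Mathlib also assigns `⊥ + ⊤ = ⊥`; this sum never occurs for proper mappings.) -/
abbrev Ext (Y : Type*) := WithBot (WithTop Y)

/-- The inclusion of `Y` into `Ext Y`. -/
abbrev fin {Y : Type*} (y : Y) : Ext Y := ((y : WithTop Y) : WithBot (WithTop Y))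

/-- Negation on `Ext Y`: `-(+∞_Y) = -∞_Y` and `-(-∞_Y) = +∞_Y`. -/
def Ext.neg {Y : Type*} [Neg Y] : Ext Y → Ext Y
  | none => ⊤
  | some none => ⊥
  | some (some y) => fin (-y)

/-- The composition `T ∘ G` of a mapping into `Z` with an extended-valued mapping `G`, pointwise:
`T (+∞_Z) = +∞_Y` (and `T (-∞_Z) = -∞_Y`, which does not occur for proper mappings). -/
def Ext.map {Z Y : Type*} (T : Z → Y) (z : Ext Z) : Ext Y := WithBot.map (WithTop.map T) z

/-- `-∞` is not a value of the mapping, and the effective domain is non-empty. -/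
def Proper {X Y : Type*} (F : X → Ext Y) : Prop :=
  (∃ x, F x ≠ ⊤) ∧ ∀ x, F x ≠ ⊥

/-- The effective domain. -/
def dom {X Y : Type*} (F : X → Ext Y) : Set X := {x | F x ≠ ⊤}

/-- The indicator mapping of `D`: `0_Y` on `D` and `+∞_Y` elsewhere. -/
def indicator {X : Type*} (Y : Type*) [Zero Y] (D : Set X) (x : X) : Ext Y :=
  open Classical in if x ∈ D then fin 0 else ⊤

/-! ### Weak ordering, weak supremum -/

section Order

variable {Y : Type*} [AddCommGroup Y] [TopologicalSpace Y]

/-- The weak ordering `v <_K w` generated by `K`: for `y₁, y₂ ∈ Y` it means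
`y₁ - y₂ ∈ -int K`, and `-∞_Y <_K y <_K +∞_Y`. -/
def WeakLT (K : Set Y) : Ext Y → Ext Y → Prop
  | none, none => False
  | none, some _ => True
  | some _, none => False
  | some none, some none => False
  | some none, some (some _) => False
  | some (some _), some none => True
  | some (some y₁), some (some y₂) => y₁ - y₂ ∈ -interior K

/-- The weak supremum `WSup M`: the set of weakly supremal elements of `M`. -/
def wSup (K : Set Y) (M : Set (Ext Y)) : Set (Ext Y) :=
  {v | (∀ w ∈ M, ¬ WeakLT K v w) ∧ ∀ v', WeakLT K v' v → ∃ w ∈ M, WeakLT K v' w}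

/-- The convention `WSup ∅ = {-∞_Y}` agrees with the definition. -/
theorem wSup_empty (K : Set Y) : wSup K ∅ = {⊥} := by
  ext v
  constructor
  · rintro ⟨-, h⟩
    by_contra hv
    rcases v with _ | v
    · exact hv rfl
    · obtain ⟨w, hw, -⟩ := h ⊥ trivial
      exact hw
  · rintro rfl
    refine ⟨fun w hw => hw.elim, ?_⟩
    rintro (_ | v') h
    · exact h.elim
    · exact h.elim

/-- The epigraph `{(x, y) ∈ X × Y : y ∈ F x + K}` of an extended-valued mapping. -/
def epi {X : Type*} (K : Set Y) (F : X → Ext Y) : Set (X × Y) :=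
  {p | ∃ κ ∈ K, fin p.2 = F p.1 + fin κ}

end Order

/-! ### Cones -/

/-- The positive dual cone `S⁺` of `S`. -/
def posDual {Z : Type*} [AddCommGroup Z] [Module ℝ Z] [TopologicalSpace Z] (S : Set Z) :
    Set (Z →L[ℝ] ℝ) :=
  {zs | ∀ s ∈ S, 0 ≤ zs s}

/-- `F` is positively `K`-lsc: `y* ∘ F` is lower semicontinuous for all `y* ∈ K⁺ \ {0}`. -/
def PositivelyLSC {X Y : Type*} [TopologicalSpace X]
    [AddCommGroup Y] [Module ℝ Y] [TopologicalSpace Y] (K : Set Y) (F : X → Ext Y) : Prop :=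
  ∀ ys ∈ posDual K, ys ≠ 0 → LowerSemicontinuous fun x => (Ext.map ys (F x) : EReal)

/-! ### Sectional convexity -/

section Sectional

variable {E : Type*} [AddCommGroup E] [Module ℝ E]

/-- `N` is `E₀`-sectionally convex: `N ∩ (E₀ + v)` is convex for all `v`. -/
def SectionallyConvex (E₀ : Submodule ℝ E) (N : Set E) : Prop :=
  ∀ v : E, Convex ℝ (N ∩ ((E₀ : Set E) + {v}))

/-- The `E₀`-sectionally convex hull of `N`: the intersection of all `E₀`-sectionally convex
sets that contain `N`. -/
def sco (E₀ : Submodule ℝ E) (N : Set E) : Set E :=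
  ⋂₀ {M | N ⊆ M ∧ SectionallyConvex E₀ M}

end Sectional

/-! ### Conjugate mappings -/

section Conjugate

variable {X Y : Type*}
  [AddCommGroup X] [Module ℝ X] [TopologicalSpace X]
  [AddCommGroup Y] [Module ℝ Y] [TopologicalSpace Y]
  [IsTopologicalAddGroup Y] [ContinuousSMul ℝ Y]

/-- The mapping `(k · x*) x = ⟨x*, x⟩ k`, as a continuous linear mapping. Here and below
`X →Lₚₜ[ℝ] Y` is `L(X, Y)` with the topology of pointwise convergence. -/
def rankOne (k : Y) (xs : X →L[ℝ] ℝ) : X →Lₚₜ[ℝ] Y :=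
  ContinuousLinearMap.toUniformConvergenceCLM _ _ _ (xs.smulRight k)

/-- The subspace `E_k = {(k · x*, r k) : x* ∈ X*, r ∈ ℝ}` of `L(X, Y) × Y`. -/
def dirSubspace (X : Type*) {Y : Type*}
    [AddCommGroup X] [Module ℝ X] [TopologicalSpace X]
    [AddCommGroup Y] [Module ℝ Y] [TopologicalSpace Y]
    [IsTopologicalAddGroup Y] [ContinuousSMul ℝ Y] (k : Y) :
    Submodule ℝ ((X →Lₚₜ[ℝ] Y) × Y) where
  carrier := {p | ∃ (xs : X →L[ℝ] ℝ) (r : ℝ), p = (rankOne k xs, r • k)}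
  zero_mem' := ⟨0, 0, by
    refine Prod.ext ?_ (by simp)
    ext x
    simp [rankOne]⟩
  add_mem' := by
    rintro _ _ ⟨x₁, r₁, rfl⟩ ⟨x₂, r₂, rfl⟩
    refine ⟨x₁ + x₂, r₁ + r₂, Prod.ext ?_ (by simp [add_smul])⟩
    ext x
    simp [rankOne, add_smul]
  smul_mem' := by
    rintro c _ ⟨x₁, r₁, rfl⟩
    refine ⟨c • x₁, c * r₁, Prod.ext ?_ (by simp [mul_smul])⟩
    ext x
    simp [rankOne, mul_smul]

/-- The conjugate mapping `F* L = WSup {L x - F x : x ∈ X}`. -/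
def conj (K : Set Y) (F : X → Ext Y) (L : X →Lₚₜ[ℝ] Y) : Set (Ext Y) :=
  wSup K (Set.range fun x => fin (L x) + Ext.neg (F x))

/-- The epigraph `{(L, y) : y ∈ F* L + K}` of the conjugate mapping. -/
def epiConj (K : Set Y) (F : X → Ext Y) : Set ((X →Lₚₜ[ℝ] Y) × Y) :=
  {p | ∃ v ∈ conj K F p.1, ∃ κ ∈ K, fin p.2 = v + fin κ}

end Conjugate

/-! ### The robust vector problem -/

section Problem

variable {X Y Z U : Type*}
  [AddCommGroup X] [Module ℝ X] [TopologicalSpace X]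
  [AddCommGroup Y] [Module ℝ Y] [TopologicalSpace Y]
  [IsTopologicalAddGroup Y] [ContinuousSMul ℝ Y]
  [AddCommGroup Z] [Module ℝ Z] [TopologicalSpace Z]

/-- The feasible set `C ∩ ⋂_u G_u⁻¹(-S)`. -/
def feasible (S : Set Z) (C : Set X) (G : U → X → Ext Z) : Set X :=
  C ∩ ⋂ u, G u ⁻¹' (fin '' (-S))

/-- The qualifying set `𝒜_k`, the union over `(z*, u) ∈ S⁺ × 𝒰` of
`epi (F + I_C + (k · z*) ∘ G_u)*`. -/
def qualifying (K : Set Y) (S : Set Z) (F : X → Ext Y) (C : Set X) (G : U → X → Ext Z) (k : Y) :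
    Set ((X →Lₚₜ[ℝ] Y) × Y) :=
  ⋃ zs ∈ posDual S, ⋃ u : U,
    epiConj K (fun x => F x + indicator Y C x + Ext.map (rankOne k zs) (G u x))

end Problem

end RVP

end

namespace RVP

/-! ### Interior points of a convex cone -/

section Cone

variable {Y : Type*} [AddCommGroup Y] [Module ℝ Y] [TopologicalSpace Y]
  [IsTopologicalAddGroup Y] [ContinuousSMul ℝ Y] {K : ConvexCone ℝ Y} {k w : Y}

/-! Since `k` is interior to `K`, membership of `(L, y)` in `epi H*` means exactly that no value `L
x - H x - y` lies in `int K` (`mem_epiConj_iff`). Such a set is closed, and along the directions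
`E_k` the condition only bounds a scalar multiple of `k` from above, so it is sectionally convex. On
feasible points `z* (G_u x) ≤ 0`, so `𝒜_k` lies in `epi (F + I_A)*`, and hence so does `cl (sco_k
𝒜_k)`.

For the converse fix `(L, y)` in `epi (F + I_A)*` and work in its section `(L, y) + E_k`, a copy of
`X* × ℝ`. The condition `L x - y + t k ∈ F x + K` with `x ∈ C` defines the closed convex epigraph
`P` of a scalar problem whose values on `A` are nonnegative. Affine minorants of its Lagrangians
correspond to points of `𝒜_k` in the section, so it suffices that `0` is a weak* limit of convex
combinations of such minorants (`zero_mem_closure_convexHull_lagrangeMinorants`). That is a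
Hahn–Banach argument: a separating functional is a point of `X × ℝ`, and some Lagrangian minorant
always violates the separation. -/

theorem zero_mem_of_isClosed {Z : Type*} [AddCommGroup Z] [Module ℝ Z] [TopologicalSpace Z]
    [ContinuousSMul ℝ Z] {S : ConvexCone ℝ Z} (hS : IsClosed (S : Set Z))
    (hne : (S : Set Z).Nonempty) : (0 : Z) ∈ (S : Set Z) := by
  obtain ⟨s, hs⟩ := hne
  have hc : Continuous fun t : ℝ => t • s := by fun_prop
  have h0 : Filter.Tendsto (fun t : ℝ => t • s) (nhdsWithin 0 (Set.Ioi 0)) (nhds 0) := by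
    simpa using (hc.tendsto 0).mono_left nhdsWithin_le_nhds
  exact hS.mem_of_tendsto h0 (by
    filter_upwards [self_mem_nhdsWithin] with t ht using S.smul_mem ht hs)

omit [IsTopologicalAddGroup Y] in
theorem smul_mem_interior (hk : k ∈ interior (K : Set Y)) {t : ℝ} (ht : 0 < t) :
    t • k ∈ interior (K : Set Y) := by
  have : t • interior (K : Set Y) ⊆ interior (K : Set Y) := by
    refine interior_maximal ?_ (isOpen_interior.smul₀ ht.ne')
    rintro _ ⟨a, ha, rfl⟩
    exact K.smul_mem ht (interior_subset ha)
  exact this ⟨k, hk, rfl⟩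

omit [ContinuousSMul ℝ Y] in
theorem add_mem_interior (hk : k ∈ interior (K : Set Y)) (hw : w ∈ (K : Set Y)) :
    k + w ∈ interior (K : Set Y) := by
  have h : interior (K : Set Y) + (K : Set Y) ⊆ interior (K : Set Y) := by
    refine interior_maximal ?_ isOpen_interior.add_right
    rintro _ ⟨a, ha, b, hb, rfl⟩
    exact K.add_mem (interior_subset ha) hb
  exact h ⟨k, hk, w, hw, rfl⟩

omit [ContinuousSMul ℝ Y] in
theorem add_smul_mem_interior (hw : w ∈ interior (K : Set Y)) (hk : k ∈ interior (K : Set Y))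
    {t : ℝ} (ht : 0 ≤ t) : w + t • k ∈ interior (K : Set Y) := by
  rcases ht.eq_or_lt with rfl | ht
  · simpa using hw
  · exact add_mem_interior hw (K.smul_mem ht (interior_subset hk))

theorem exists_sub_smul_mem_interior (k : Y) (hw : w ∈ interior (K : Set Y)) :
    ∃ ε > (0 : ℝ), w - ε • k ∈ interior (K : Set Y) := by
  have hc : Continuous fun t : ℝ => w - t • k := by fun_prop
  have hev : ∀ᶠ t : ℝ in nhdsWithin 0 (Set.Ioi 0), w - t • k ∈ interior (K : Set Y) :=
    nhdsWithin_le_nhds (hc.continuousAt.eventually_mem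
      (isOpen_interior.mem_nhds (by simpa using hw)))
  obtain ⟨ε, h, hε⟩ := (hev.and self_mem_nhdsWithin).exists
  exact ⟨ε, hε, h⟩

/-- An interior point is an order unit: `k + ε w` stays interior for small `ε`, and dividing by `ε`
gives the claim. -/
theorem exists_add_smul_mem_interior (hk : k ∈ interior (K : Set Y)) (w : Y) :
    ∃ t > (0 : ℝ), w + t • k ∈ interior (K : Set Y) := by
  obtain ⟨ε, hε, h⟩ := exists_sub_smul_mem_interior (-w) hk
  refine ⟨ε⁻¹, by positivity, ?_⟩
  obtain ⟨δ, hδ, h'⟩ := exists_sub_smul_mem_interior k h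
  have h2 : w + ε⁻¹ • k = ε⁻¹ • (k - ε • -w - δ • k) + (ε⁻¹ * δ) • k := by
    simp only [smul_sub, smul_neg, smul_smul]
    rw [inv_mul_cancel₀ hε.ne']
    module
  rw [h2, add_comm]
  exact add_mem_interior (smul_mem_interior hk (by positivity)) (K.smul_mem (by positivity) (interior_subset h'))

omit [IsTopologicalAddGroup Y] in
theorem smul_mem_of_nonneg (hK : IsClosed (K : Set Y)) (hk : k ∈ (K : Set Y)) {t : ℝ}
    (ht : 0 ≤ t) : t • k ∈ (K : Set Y) := by
  rcases ht.eq_or_lt with rfl | ht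
  · simpa using zero_mem_of_isClosed hK ⟨k, hk⟩
  · exact K.smul_mem ht hk

end Cone

/-! ### Extended-valued mappings -/

section Ext

variable {Y Z : Type*}

theorem Ext.eq_fin_of_ne {v : Ext Y} (hb : v ≠ ⊥) (ht : v ≠ ⊤) : ∃ y, v = fin y := by
  rcases v with _ | _ | y
  · exact (hb rfl).elim
  · exact (ht rfl).elim
  · exact ⟨y, rfl⟩

theorem fin_injective : Function.Injective (fin : Y → Ext Y) := fun _ _ h =>
  WithTop.coe_injective (WithBot.coe_injective h)

variable [AddCommGroup Y]

theorem add_indicator_eq_fin_iff {X : Type*} {v : Ext Y} {D : Set X} {x : X} {y : Y} :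
    v + indicator Y D x = fin y ↔ v = fin y ∧ x ∈ D := by
  by_cases hx : x ∈ D
  · simp only [indicator, hx, if_true, and_true]
    rcases v with _ | _ | a
    · exact Iff.rfl
    · exact Iff.rfl
    · change fin (a + 0) = fin y ↔ _
      rw [add_zero]; rfl
  · simp only [indicator, hx, if_false, and_false, iff_false]
    rcases v with _ | _ | a
    · exact fun h => WithBot.bot_ne_coe h
    · exact fun h => WithTop.top_ne_coe (WithBot.coe_injective h)
    · exact fun h => WithTop.top_ne_coe (WithBot.coe_injective h)

theorem add_map_eq_fin_iff {v : Ext Y} {T : Z → Y} {g : Ext Z} {y : Y} :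
    v + Ext.map T g = fin y ↔ ∃ a z, v = fin a ∧ g = fin z ∧ y = a + T z := by
  constructor
  · intro h
    rcases v with _ | _ | a
    · exact (WithBot.bot_ne_coe h).elim
    · rcases g with _ | _ | z
      · exact (WithBot.bot_ne_coe h).elim
      · exact (WithTop.top_ne_coe (WithBot.coe_injective h)).elim
      · exact (WithTop.top_ne_coe (WithBot.coe_injective h)).elim
    · rcases g with _ | _ | z
      · exact (WithBot.bot_ne_coe h).elim
      · exact (WithTop.top_ne_coe (WithBot.coe_injective h)).elim
      · exact ⟨a, z, rfl, rfl, (fin_injective h).symm⟩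
  · rintro ⟨a, z, rfl, rfl, rfl⟩
    rfl

theorem fin_eq_add_fin_iff {v : Ext Y} {y c : Y} :
    fin y = v + fin c ↔ v = fin (y - c) := by
  constructor
  · intro h
    rcases v with _ | _ | a
    · exact (WithBot.bot_ne_coe h.symm).elim
    · exact (WithTop.top_ne_coe (WithBot.coe_injective h.symm)).elim
    · rw [fin_injective (h : fin y = fin (a + c)), add_sub_cancel_right]; rfl
  · rintro rfl
    change fin y = fin (y - c + c)
    rw [sub_add_cancel]

theorem mem_epi_iff [TopologicalSpace Y] {X : Type*} {K : Set Y} {F : X → Ext Y} {x : X} {y : Y} :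
    (x, y) ∈ epi K F ↔ ∃ v, F x = fin v ∧ y - v ∈ K := by
  constructor
  · rintro ⟨c, hc, h⟩
    exact ⟨y - c, fin_eq_add_fin_iff.1 h, by simpa using hc⟩
  · rintro ⟨v, hv, h⟩
    exact ⟨y - v, h, fin_eq_add_fin_iff.2 (by simpa using hv)⟩

end Ext

/-! ### The epigraph of the conjugate mapping -/

section Conjugate

variable {X Y : Type*}
  [AddCommGroup X] [Module ℝ X] [TopologicalSpace X]
  [AddCommGroup Y] [Module ℝ Y] [TopologicalSpace Y]
  [IsTopologicalAddGroup Y] [ContinuousSMul ℝ Y]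
  {K : ConvexCone ℝ Y} {k : Y} {H : X → Ext Y}

/-- Turns the weak supremum into a pointwise condition. The nontrivial direction lowers `y` along
`k` as far as the condition survives; the point reached is weakly supremal. -/
theorem mem_epiConj_iff (hK : IsClosed (K : Set Y)) (hk : k ∈ interior (K : Set Y))
    (hne : ∃ x h, H x = fin h) (hbot : ∀ x, H x ≠ ⊥)
    {p : (X →Lₚₜ[ℝ] Y) × Y} :
    p ∈ epiConj (K : Set Y) H ↔
      ∀ x h, H x = fin h → p.1 x - h - p.2 ∉ interior (K : Set Y) := by
  obtain ⟨L, y⟩ := p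
  constructor
  · rintro ⟨v, ⟨hv, -⟩, c, hc, hy⟩ x h hx hmem
    rw [fin_eq_add_fin_iff.1 hy] at hv
    refine hv _ ⟨x, rfl⟩ ?_
    simp only [hx]
    change y - c - (L x + -h) ∈ -interior (K : Set Y)
    rw [Set.mem_neg]
    have e : -(y - c - (L x + -h)) = L x - h - y + c := by abel
    exact e ▸ add_mem_interior hmem hc
  · intro hp
    -- `D` consists of the shifts `t` for which `y - t k` is strictly dominated by some value; its
    -- infimum `τ` yields the supremal element `y - τ k`.
    set D : Set ℝ := {t | ∃ x h, H x = fin h ∧ L x - h - y + t • k ∈ interior (K : Set Y)} with hD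
    have hpos : ∀ t ∈ D, 0 ≤ t := by
      rintro t ⟨x, h, hx, hm⟩
      by_contra! ht
      refine hp x h hx ?_
      simpa [add_assoc, ← add_smul] using
        add_smul_mem_interior hm hk (t := -t) (by linarith)
    have hbdd : BddBelow D := ⟨0, hpos⟩
    obtain ⟨x₀, h₀, hx₀⟩ := hne
    have hDne : D.Nonempty := by
      obtain ⟨t, -, ht⟩ := exists_add_smul_mem_interior hk (L x₀ - h₀ - y)
      exact ⟨t, x₀, h₀, hx₀, ht⟩
    set τ := sInf D
    -- `int K` is open, so `D` has no least element.
    have hτ : τ ∉ D := by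
      rintro ⟨x, h, hx, hm⟩
      obtain ⟨ε, hε, hm'⟩ := exists_sub_smul_mem_interior k hm
      have : τ ≤ τ - ε := csInf_le hbdd ⟨x, h, hx, by
        have e : L x - h - y + (τ - ε) • k = L x - h - y + τ • k - ε • k := by module
        exact e ▸ hm'⟩
      linarith
    have hτ0 : 0 ≤ τ := le_csInf hDne hpos
    refine ⟨fin (y - τ • k), ⟨?_, ?_⟩, τ • k, smul_mem_of_nonneg hK (interior_subset hk) hτ0,
      fin_eq_add_fin_iff.2 rfl⟩
    · rintro _ ⟨x, rfl⟩ hlt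
      by_cases hx : H x = ⊤
      · simp only [hx] at hlt
        exact hlt
      · obtain ⟨h, hh⟩ := Ext.eq_fin_of_ne (hbot x) hx
        refine hτ ⟨x, h, hh, ?_⟩
        simp only [hh] at hlt
        change y - τ • k - (L x + -h) ∈ -interior (K : Set Y) at hlt
        rw [Set.mem_neg] at hlt
        have e : L x - h - y + τ • k = -(y - τ • k - (L x + -h)) := by abel
        exact e ▸ hlt
    · rintro (_ | _ | a) hlt
      · refine ⟨_, ⟨x₀, rfl⟩, ?_⟩
        simp only [hx₀]
        trivial
      · exact hlt.elim
      · change a - (y - τ • k) ∈ -interior (K : Set Y) at hlt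
        rw [Set.mem_neg] at hlt
        obtain ⟨ε, hε, hm⟩ := exists_sub_smul_mem_interior k hlt
        obtain ⟨t, ⟨x, h, hx, hxt⟩, htlt⟩ := exists_lt_of_csInf_lt hDne (lt_add_of_pos_right τ hε)
        refine ⟨_, ⟨x, rfl⟩, ?_⟩
        simp only [hx]
        change a - (L x + -h) ∈ -interior (K : Set Y)
        rw [Set.mem_neg]
        have e : -(a - (L x + -h)) = L x - h - y + t • k + (-(a - (y - τ • k)) - ε • k)
            + (τ + ε - t) • k := by module
        rw [e]
        exact add_smul_mem_interior (add_mem_interior hxt (interior_subset hm)) hk (by linarith)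

theorem isClosed_epiConj (hK : IsClosed (K : Set Y)) (hk : k ∈ interior (K : Set Y))
    (hne : ∃ x h, H x = fin h) (hbot : ∀ x, H x ≠ ⊥) :
    IsClosed (epiConj (K : Set Y) H) := by
  have : epiConj (K : Set Y) H = ⋂ (x) (h) (_ : H x = fin h),
      {p : (X →Lₚₜ[ℝ] Y) × Y | p.1 x - h - p.2 ∉ interior (K : Set Y)} := by
    ext p
    simp [mem_epiConj_iff hK hk hne hbot]
  rw [this]
  refine isClosed_iInter fun x => isClosed_iInter fun h => isClosed_iInter fun _ => ?_
  have hc : Continuous fun p : (X →Lₚₜ[ℝ] Y) × Y => p.1 x - h - p.2 :=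
    (((continuous_eval_const x).comp continuous_fst).sub continuous_const).sub continuous_snd
  exact (isOpen_interior.preimage hc).isClosed_compl

/-- Within a section, each `x` contributes a condition `w + s k ∉ int K` with `s` affine in the
parameters. The admissible `s` form a lower half-line because `k ∈ int K`. -/
theorem sectionallyConvex_epiConj (hK : IsClosed (K : Set Y)) (hk : k ∈ interior (K : Set Y))
    (hne : ∃ x h, H x = fin h) (hbot : ∀ x, H x ≠ ⊥) :
    SectionallyConvex (dirSubspace X k) (epiConj (K : Set Y) H) := by
  rintro v p ⟨hp, hpv⟩ q ⟨hq, hqv⟩ a b ha hb hab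
  obtain ⟨p', hp', v, rfl, rfl⟩ := hpv
  obtain ⟨q', hq', w, hw, rfl⟩ := hqv
  obtain rfl : v = w := hw.symm
  refine ⟨?_, ⟨a • p' + b • q', add_mem (Submodule.smul_mem _ _ hp') (Submodule.smul_mem _ _ hq'),
    _, rfl, ?_⟩⟩
  · rw [mem_epiConj_iff hK hk hne hbot] at hp hq ⊢
    intro x h hx hm
    obtain ⟨x₁, r₁, rfl⟩ := hp'
    obtain ⟨x₂, r₂, rfl⟩ := hq'
    have h1 := hp x h hx
    have h2 := hq x h hx
    obtain ⟨L, y⟩ := v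
    simp only [Prod.fst_add, Prod.snd_add, Prod.smul_fst, Prod.smul_snd, rankOne,
      add_apply, smul_apply,
      ContinuousLinearMap.toUniformConvergenceCLM_apply, ContinuousLinearMap.smulRight_apply]
      at hm h1 h2
    obtain rfl : a = 1 - b := by linarith
    -- A violation inside the segment passes to the endpoint with the larger coefficient of `k`.
    rcases le_total ((x₂ x - r₂) - (x₁ x - r₁)) 0 with hs | hs
    · refine h1 ?_
      have := add_smul_mem_interior hm hk (t := b * -((x₂ x - r₂) - (x₁ x - r₁)))
        (mul_nonneg hb (by linarith))
      convert this using 1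
      module
    · refine h2 ?_
      have := add_smul_mem_interior hm hk (t := (1 - b) * ((x₂ x - r₂) - (x₁ x - r₁)))
        (mul_nonneg ha hs)
      convert this using 1
      module
  · change a • p' + b • q' + v = a • (p' + v) + b • (q' + v)
    rw [smul_add, smul_add, add_add_add_comm, ← add_smul, hab, one_smul]

end Conjugate

end RVP

namespace RVP

/-! ### Affine minorants and separation in the weak dual -/

section Scalar

variable {X : Type*} [AddCommGroup X] [Module ℝ X] [TopologicalSpace X]

/-- Separate `(x₁, τ)` from `P`. If the hyperplane is vertical, add a large multiple of it to a
nonvertical one. The latter exists because separating `(x₀, τ₀)` from a set containing `(x₀, t₀)`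
rules out a vertical hyperplane. -/
theorem exists_affine_minorant [IsTopologicalAddGroup X] [ContinuousSMul ℝ X]
    [LocallyConvexSpace ℝ X] {P : Set (X × ℝ)} (hconv : Convex ℝ P) (hcl : IsClosed P)
    (hup : ∀ x t s, (x, t) ∈ P → t ≤ s → (x, s) ∈ P)
    {x₀ : X} {t₀ τ₀ : ℝ} (h₀ : (x₀, t₀) ∈ P) (hτ₀ : (x₀, τ₀) ∉ P)
    {x₁ : X} {τ : ℝ} (hτ : (x₁, τ) ∉ P) :
    ∃ (a : X →L[ℝ] ℝ) (r : ℝ), (∀ x t, (x, t) ∈ P → a x - r ≤ t) ∧ τ < a x₁ - r := by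
  have sep : ∀ {x : X} {τ : ℝ}, (x, τ) ∉ P → ∃ (a : X →L[ℝ] ℝ) (α δ : ℝ), 0 ≤ α ∧
      (∀ x t, (x, t) ∈ P → δ < a x + α * t) ∧ a x + α * τ < δ := by
    intro x τ h
    obtain ⟨f, δ, hx, hP⟩ := geometric_hahn_banach_point_closed hconv hcl h
    have hf : ∀ x t, f (x, t) = f.comp (ContinuousLinearMap.inl ℝ X ℝ) x + f (0, 1) * t := by
      intro x t
      have : (x, t) = (x, 0) + t • ((0 : X), (1 : ℝ)) := by simp
      rw [this, map_add, map_smul, smul_eq_mul, mul_comm]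
      rfl
    refine ⟨f.comp (ContinuousLinearMap.inl ℝ X ℝ), f (0, 1), δ, ?_,
      fun x t ht => hf x t ▸ hP _ ht, hf x τ ▸ hx⟩
    -- With a negative slope, raising `t` above `x₀` would eventually cross the hyperplane.
    by_contra! hα
    set c := f.comp (ContinuousLinearMap.inl ℝ X ℝ) x₀
    set t := max t₀ ((δ - c) / f (0, 1))
    have h1 := hP _ (hup x₀ t₀ t h₀ (le_max_left _ _))
    rw [hf] at h1
    have h2 : (δ - c) / f (0, 1) ≤ t := le_max_right _ _
    rw [div_le_iff_of_neg hα] at h2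
    linarith
  have nonvert : ∀ {x : X} {τ : ℝ} {a : X →L[ℝ] ℝ} {α δ : ℝ}, 0 < α →
      (∀ x t, (x, t) ∈ P → δ < a x + α * t) → a x + α * τ < δ →
      ∃ (b : X →L[ℝ] ℝ) (r : ℝ), (∀ x t, (x, t) ∈ P → b x - r ≤ t) ∧ τ < b x - r := by
    intro x τ a α δ hα hP hx
    refine ⟨-(α⁻¹ • a), -(α⁻¹ * δ), fun x t ht => ?_, ?_⟩
    · have := hP x t ht
      have e : (-(α⁻¹ • a)) x - -(α⁻¹ * δ) = (δ - a x) / α := by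
        simp; field_simp; ring
      rw [e, div_le_iff₀ hα]
      linarith
    · have e : (-(α⁻¹ • a)) x - -(α⁻¹ * δ) = (δ - a x) / α := by
        simp; field_simp; ring
      rw [e, lt_div_iff₀ hα]
      linarith
  obtain ⟨b, s, hb, -⟩ : ∃ (b : X →L[ℝ] ℝ) (s : ℝ),
      (∀ x t, (x, t) ∈ P → b x - s ≤ t) ∧ τ₀ < b x₀ - s := by
    obtain ⟨a, α, δ, hα, hP, hx⟩ := sep hτ₀
    refine nonvert (hα.lt_of_ne' ?_) hP hx
    rintro rfl
    have := hP _ _ h₀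
    linarith
  obtain ⟨a, α, δ, hα, hP, hx⟩ := sep hτ
  rcases hα.eq_or_lt with rfl | hα
  · simp only [zero_mul, add_zero] at hP hx
    set n := max 0 ((τ - (b x₁ - s)) / (δ - a x₁) + 1)
    have hn : (τ - (b x₁ - s)) / (δ - a x₁) < n :=
      (lt_add_one _).trans_le (le_max_right _ _)
    have hn0 : 0 ≤ n := le_max_left _ _
    rw [div_lt_iff₀ (by linarith)] at hn
    refine ⟨b - n • a, s - n * δ, fun x t ht => ?_, ?_⟩
    · have h1 := hb x t ht
      have h2 := mul_nonneg hn0 (sub_nonneg.2 (hP x t ht).le)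
      simp
      nlinarith
    · simp
      nlinarith
  · exact nonvert hα hP hx

/-- Separation of a point from a closed convex set in `X* × ℝ`, with the weak* topology on `X*`. -/
theorem weakDual_prod_separation {N : Set (WeakDual ℝ X × ℝ)} (hconv : Convex ℝ N)
    (hcl : IsClosed N) {q : WeakDual ℝ X × ℝ} (hq : q ∉ N) :
    ∃ (x : X) (β δ : ℝ), (∀ p ∈ N, p.1 x + β * p.2 < δ) ∧ δ < q.1 x + β * q.2 := by
  have : LocallyConvexSpace ℝ (WeakDual ℝ X) :=
    inferInstanceAs (LocallyConvexSpace ℝ (WeakBilin (topDualPairing ℝ X)))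
  obtain ⟨f, δ, hN, hδ⟩ := geometric_hahn_banach_closed_point hconv hcl hq
  -- Weak* continuous functionals on `X*` are evaluations at points of `X`.
  obtain ⟨x, hx⟩ := LinearMap.dualEmbedding_surjective (topDualPairing ℝ X)
    (f.comp (ContinuousLinearMap.inl ℝ (WeakDual ℝ X) ℝ))
  have hf : ∀ p : WeakDual ℝ X × ℝ, f p = p.1 x + f (0, 1) * p.2 := by
    rintro ⟨w, t⟩
    have : (w, t) = (w, 0) + t • ((0 : WeakDual ℝ X), (1 : ℝ)) := by simp
    rw [this, map_add, map_smul, smul_eq_mul, mul_comm]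
    have := congrArg (fun g => g w) hx
    have h2 : w x = f (w, 0) := this
    simp [h2]
  refine ⟨x, f (0, 1), δ, fun p hp => hf p ▸ hN p hp, hf q ▸ hδ⟩

variable {Z U : Type*} [IsTopologicalAddGroup X] [ContinuousSMul ℝ X] [LocallyConvexSpace ℝ X]
  [AddCommGroup Z] [Module ℝ Z] [TopologicalSpace Z] [IsTopologicalAddGroup Z]
  [ContinuousSMul ℝ Z] [LocallyConvexSpace ℝ Z]

/-- The pairs `(x*, r)` for which `x* - r` minorizes the Lagrangian of the scalar problem with
objective epigraph `P` and constraint epigraphs `Q u`. -/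
def lagrangeMinorants (S : Set Z) (P : Set (X × ℝ)) (Q : U → Set (X × Z)) :
    Set (WeakDual ℝ X × ℝ) :=
  {p | ∃ zs ∈ posDual S, ∃ u, ∀ x t z, (x, t) ∈ P → (x, z) ∈ Q u → p.1 x - p.2 ≤ t + zs z}

/-- A separating functional is normalized to a point `(x₁, δ₁)` with `δ₁ < 0` and `a x₁ - r < δ₁`
for every minorant `(a, r)`. If the point is outside `P`, a minorant of `P` alone contradicts this.
If it is in `P`, then `x₁` is infeasible, and separating `(x₁, 0)` from some `Q u` supplies a
multiplier in `S⁺` whose large multiples give the contradiction. -/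
theorem zero_mem_closure_convexHull_lagrangeMinorants [Nonempty U] (S : ConvexCone ℝ Z)
    {P : Set (X × ℝ)} (hconv : Convex ℝ P) (hcl : IsClosed P)
    (hup : ∀ x t s, (x, t) ∈ P → t ≤ s → (x, s) ∈ P)
    {Q : U → Set (X × Z)} (hQconv : ∀ u, Convex ℝ (Q u)) (hQcl : ∀ u, IsClosed (Q u))
    (hQup : ∀ u x z, ∀ s ∈ (S : Set Z), (x, z) ∈ Q u → (x, z + s) ∈ Q u)
    {x₀ : X} {t₀ : ℝ} (h₀ : (x₀, t₀) ∈ P) (hQ₀ : ∀ u, (x₀, (0 : Z)) ∈ Q u)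
    (hmin : ∀ x t, (x, t) ∈ P → (∀ u, (x, (0 : Z)) ∈ Q u) → 0 ≤ t) :
    (0 : WeakDual ℝ X × ℝ) ∈ closure (convexHull ℝ (lagrangeMinorants (S : Set Z) P Q)) := by
  by_contra h0
  obtain ⟨x', β, δ, hB, hδ⟩ :=
    weakDual_prod_separation (convex_convexHull ℝ _).closure isClosed_closure h0
  replace hδ : δ < 0 := by
    have e : (0 : WeakDual ℝ X × ℝ).1 x' + β * (0 : WeakDual ℝ X × ℝ).2 = 0 := by
      change (0 : ℝ) + β * 0 = 0
      ring
    exact e ▸ hδ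
  replace hB : ∀ (a : X →L[ℝ] ℝ) (r : ℝ), (∃ zs ∈ posDual (S : Set Z), ∃ u, ∀ x t z, (x, t) ∈ P →
      (x, z) ∈ Q u → a x - r ≤ t + zs z) → a x' + β * r < δ := fun a r hp =>
    hB ((a : WeakDual ℝ X), r) (subset_closure (subset_convexHull ℝ _ hp))
  have hneg : (x₀, (-1 : ℝ)) ∉ P := fun h => by linarith [hmin _ _ h hQ₀]
  have hzero : (0 : Z →L[ℝ] ℝ) ∈ posDual (S : Set Z) := fun s _ => by simp
  obtain ⟨b, s, hb, -⟩ := exists_affine_minorant hconv hcl hup h₀ hneg hneg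
  -- Increasing `r` keeps a minorant a minorant, so `β > 0` would break the separation bound.
  have hβ : β ≤ 0 := by
    by_contra! hβ
    set r := max s ((δ - b x') / β)
    have h1 := hB b r ⟨0, hzero, Classical.arbitrary U, fun x t z hx _ => by
      have := hb x t hx
      have : s ≤ r := le_max_left _ _
      simp; linarith⟩
    have h2 : (δ - b x') / β ≤ r := le_max_right _ _
    rw [div_le_iff₀ hβ] at h2
    linarith
  obtain ⟨x₁, δ₁, hδ₁, hB₁⟩ : ∃ (x₁ : X) (δ₁ : ℝ), δ₁ < 0 ∧ ∀ (a : X →L[ℝ] ℝ) (r : ℝ),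
      (∃ zs ∈ posDual (S : Set Z), ∃ u, ∀ x t z, (x, t) ∈ P →
      (x, z) ∈ Q u → a x - r ≤ t + zs z) → a x₁ - r < δ₁ := by
    rcases hβ.eq_or_lt with rfl | hβ
    -- If `β = 0`, tilt by `x₀`: every minorant satisfies `a x₀ - r ≤ t₀`, and the multiple of `x'`
    -- is chosen to contribute less than `-(t₀ + 1)`.
    · refine ⟨((t₀ + 1) / (-δ)) • x' + x₀, -1, by norm_num, fun a r hp => ?_⟩
      have h1 := hB a r hp
      obtain ⟨zs, -, u, h⟩ := hp
      have h2 := h x₀ t₀ 0 h₀ (hQ₀ u)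
      have ht₀ := hmin _ _ h₀ hQ₀
      rw [map_zero, add_zero] at h2
      have h3 : (t₀ + 1) / (-δ) * a x' < (t₀ + 1) / (-δ) * δ :=
        mul_lt_mul_of_pos_left (by linarith) (div_pos (by linarith) (by linarith))
      have h4 : (t₀ + 1) / (-δ) * δ = -(t₀ + 1) := by
        have := hδ.ne
        field_simp
      simp only [map_add, map_smul, smul_eq_mul]
      linarith
    · refine ⟨(-β)⁻¹ • x', (-β)⁻¹ * δ, mul_neg_of_pos_of_neg (by
        rw [inv_pos]; linarith) hδ, fun a r hp => ?_⟩
      have h1 := mul_lt_mul_of_pos_left (hB a r hp) (inv_pos.2 (neg_pos.2 hβ))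
      have h2 : (-β)⁻¹ * (β * r) = -r := by
        have := hβ.ne
        field_simp
      rw [map_smul, smul_eq_mul]
      linarith
  by_cases hx₁ : (x₁, δ₁) ∈ P
  · obtain ⟨u, hu⟩ : ∃ u, (x₁, (0 : Z)) ∉ Q u := by
      by_contra! h
      linarith [hmin _ _ hx₁ h]
    obtain ⟨f, c, hc, hQ⟩ := geometric_hahn_banach_point_closed (hQconv u) (hQcl u) hu
    set a := f.comp (ContinuousLinearMap.inl ℝ X Z)
    set zs := f.comp (ContinuousLinearMap.inr ℝ X Z)
    have hf : ∀ x z, f (x, z) = a x + zs z := by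
      intro x z
      have : (x, z) = (x, 0) + (0, z) := by simp
      rw [this, map_add]
      rfl
    rw [hf, map_zero, add_zero] at hc
    have hzs : zs ∈ posDual (S : Set Z) := by
      intro z hz
      by_contra! hlt
      set n := max 1 ((c - a x₀) / zs z)
      have hn : 0 < n := lt_of_lt_of_le one_pos (le_max_left _ _)
      have h1 := hQ _ (hQup u x₀ 0 (n • z) (S.smul_mem hn hz) (hQ₀ u))
      have h2 : (c - a x₀) / zs z ≤ n := le_max_right _ _
      rw [hf, zero_add, map_smul, smul_eq_mul] at h1
      rw [div_le_iff_of_neg hlt] at h2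
      linarith
    -- `n` is large enough that the minorant `b - s` plus `n (c - a)` reaches `δ₁` at `x₁`.
    set n := max 0 ((δ₁ - (b x₁ - s)) / (c - a x₁))
    have hn0 : 0 ≤ n := le_max_left _ _
    have hn : (δ₁ - (b x₁ - s)) / (c - a x₁) ≤ n := le_max_right _ _
    rw [div_le_iff₀ (by linarith)] at hn
    have h1 := hB₁ (b - n • a) (s - n * c) ⟨n • zs, fun z hz => by
      have := hzs z hz
      simp only [smul_apply, smul_eq_mul]
      positivity, u, fun x t z hx hz => by
        have h1 := hb x t hx
        have h2 := hQ _ hz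
        rw [hf] at h2
        have h3 := mul_nonneg hn0 (sub_nonneg.2 h2.le)
        simp only [smul_apply, sub_apply, smul_eq_mul]
        nlinarith⟩
    simp only [smul_apply, sub_apply, smul_eq_mul] at h1
    nlinarith
  · obtain ⟨a, r, ha, hlt⟩ := exists_affine_minorant hconv hcl hup h₀ hneg hx₁
    have := hB₁ a r ⟨0, hzero, Classical.arbitrary U, fun x t z hx _ => by
      simpa using ha x t hx⟩
    linarith

end Scalar

end RVP

namespace RVP

/-! ### Closedness of the epigraph of a positively lower semicontinuous mapping -/

theorem exists_posDual_neg {Y : Type*} [AddCommGroup Y] [Module ℝ Y] [TopologicalSpace Y]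
    [IsTopologicalAddGroup Y] [ContinuousSMul ℝ Y] [LocallyConvexSpace ℝ Y]
    {K : ConvexCone ℝ Y} (hK : IsClosed (K : Set Y)) (hne : (K : Set Y).Nonempty) {y : Y}
    (hy : y ∉ (K : Set Y)) : ∃ ys ∈ posDual (K : Set Y), ys y < 0 := by
  let C : ProperCone ℝ Y :=
    ⟨K.toPointedCone (zero_mem_of_isClosed hK hne), hK⟩
  obtain ⟨f, hf, hfy⟩ := C.hyperplane_separation_point (x₀ := y) hy
  exact ⟨f, fun s hs => hf s hs, hfy⟩

/-- `K` is an intersection of half-spaces, so the epigraph is cut out by the closed conditions `y*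
(F x) ≤ y* y`. Properness of `K` provides a nonzero `y*`, which excludes points where `F` is `⊤`. -/
theorem isClosed_epi_of_positivelyLSC {X Y : Type*} [TopologicalSpace X]
    [AddCommGroup Y] [Module ℝ Y] [TopologicalSpace Y]
    [IsTopologicalAddGroup Y] [ContinuousSMul ℝ Y] [LocallyConvexSpace ℝ Y]
    {K : ConvexCone ℝ Y} (hK : IsClosed (K : Set Y)) (hne : (K : Set Y).Nonempty)
    (hK' : (K : Set Y) ≠ Set.univ) {F : X → Ext Y} (hbot : ∀ x, F x ≠ ⊥)
    (hF : PositivelyLSC (K : Set Y) F) : IsClosed (epi (K : Set Y) F) := by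
  have : epi (K : Set Y) F = ⋂ ys ∈ posDual (K : Set Y), ⋂ _ : ys ≠ 0,
      {p : X × Y | (Ext.map ys (F p.1) : EReal) ≤ ((ys p.2 : ℝ) : EReal)} := by
    ext ⟨x, y⟩
    simp only [Set.mem_iInter, mem_epi_iff]
    constructor
    · rintro ⟨v, hv, h⟩ ys hys -
      change (Ext.map ys (F x) : EReal) ≤ ((ys y : ℝ) : EReal)
      rw [hv]
      change ((ys v : ℝ) : EReal) ≤ ((ys y : ℝ) : EReal)
      have := hys _ h
      rw [map_sub] at this
      exact EReal.coe_le_coe_iff.2 (by linarith)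
    · intro h
      by_cases hx : F x = ⊤
      · obtain ⟨w, hw⟩ := (Set.ne_univ_iff_exists_notMem _).1 hK'
        obtain ⟨ys, hys, hneg⟩ := exists_posDual_neg hK hne hw
        have h1 : (Ext.map ys (F x) : EReal) ≤ ((ys y : ℝ) : EReal) :=
          h ys hys (by rintro rfl; simp at hneg)
        rw [hx] at h1
        exact absurd (top_le_iff.1 (h1 : (⊤ : EReal) ≤ _)) (EReal.coe_ne_top _)
      · obtain ⟨v, hv⟩ := Ext.eq_fin_of_ne (hbot x) hx
        refine ⟨v, hv, ?_⟩
        by_contra hyv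
        obtain ⟨ys, hys, hneg⟩ := exists_posDual_neg hK hne hyv
        have h1 : (Ext.map ys (F x) : EReal) ≤ ((ys y : ℝ) : EReal) :=
          h ys hys (by rintro rfl; simp at hneg)
        rw [hv] at h1
        have h2 : ys v ≤ ys y :=
          EReal.coe_le_coe_iff.1 (h1 : ((ys v : ℝ) : EReal) ≤ ((ys y : ℝ) : EReal))
        rw [map_sub] at hneg
        linarith
  rw [this]
  refine isClosed_biInter fun ys hys => isClosed_iInter fun h0 => ?_
  have hc : Continuous fun p : X × Y => (p.1, ((ys p.2 : ℝ) : EReal)) :=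
    continuous_fst.prodMk (continuous_coe_real_ereal.comp (ys.continuous.comp continuous_snd))
  exact (hF ys hys h0).isClosed_epigraph.preimage hc

/-! ### Sectional convexity and rank-one directions -/

section Sectional

variable {X Y : Type*}
  [AddCommGroup X] [Module ℝ X] [TopologicalSpace X]
  [AddCommGroup Y] [Module ℝ Y] [TopologicalSpace Y]
  [IsTopologicalAddGroup Y] [ContinuousSMul ℝ Y]

theorem sectionallyConvex_sco {E : Type*} [AddCommGroup E] [Module ℝ E] (E₀ : Submodule ℝ E)
    (N : Set E) : SectionallyConvex E₀ (sco E₀ N) := by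
  rintro v p ⟨hp, hpv⟩ q ⟨hq, hqv⟩ a b ha hb hab
  have h : ∀ M, N ⊆ M → SectionallyConvex E₀ M → a • p + b • q ∈ M ∩ ((E₀ : Set E) + {v}) :=
    fun M hNM hM => hM v ⟨hp M ⟨hNM, hM⟩, hpv⟩ ⟨hq M ⟨hNM, hM⟩, hqv⟩ ha hb hab
  exact ⟨fun M hM => (h M hM.1 hM.2).1,
    -- The whole space is itself a competitor, which gives membership in the coset.
    (h Set.univ (Set.subset_univ _) fun w => by
      simpa using (E₀.convex).add (convex_singleton w)).2⟩

theorem subset_sco {E : Type*} [AddCommGroup E] [Module ℝ E] (E₀ : Submodule ℝ E)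
    (N : Set E) : N ⊆ sco E₀ N := fun _ hp _ hM => hM.1 hp

/-- The affine parametrization `(x*, r) ↦ q + (k · x*, r k)` of the section of `L(X, Y) × Y`
through `q`. -/
noncomputable def sectionMap (k : Y) (q : (X →Lₚₜ[ℝ] Y) × Y) (p : WeakDual ℝ X × ℝ) : (X →Lₚₜ[ℝ] Y) × Y :=
  q + (rankOne k p.1, p.2 • k)

theorem continuous_sectionMap (k : Y) (q : (X →Lₚₜ[ℝ] Y) × Y) : Continuous (sectionMap k q) := by
  refine Continuous.prodMk ?_ (continuous_const.add (continuous_snd.smul continuous_const))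
  refine PointwiseConvergenceCLM.continuous_of_continuous_eval fun x => ?_
  exact continuous_const.add
    (((WeakDual.eval_continuous x).comp continuous_fst).smul continuous_const)

theorem sectionMap_combo (k : Y) (q : (X →Lₚₜ[ℝ] Y) × Y) (p₁ p₂ : WeakDual ℝ X × ℝ) {a b : ℝ}
    (hab : a + b = 1) : sectionMap k q (a • p₁ + b • p₂) =
      a • sectionMap k q p₁ + b • sectionMap k q p₂ := by
  obtain rfl : a = 1 - b := by linarith
  refine Prod.ext ?_ ?_
  · ext x
    change q.1 x + ((1 - b) * p₁.1 x + b * p₂.1 x) • k =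
      (1 - b) • (q.1 x + p₁.1 x • k) + b • (q.1 x + p₂.1 x • k)
    module
  · change q.2 + ((1 - b) * p₁.2 + b * p₂.2) • k =
      (1 - b) • (q.2 + p₁.2 • k) + b • (q.2 + p₂.2 • k)
    module

/-- Lets ordinary convex hulls in `X* × ℝ` be mapped into sectionally convex hulls. -/
theorem convex_preimage_sectionMap {k : Y} {N : Set ((X →Lₚₜ[ℝ] Y) × Y)}
    (hN : SectionallyConvex (dirSubspace X k) N) (q : (X →Lₚₜ[ℝ] Y) × Y) :
    Convex ℝ (sectionMap k q ⁻¹' N) := by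
  have hmem : ∀ p, sectionMap k q p ∈ ((dirSubspace X k : Set ((X →Lₚₜ[ℝ] Y) × Y)) + {q}) :=
    fun p => ⟨(rankOne k p.1, p.2 • k), ⟨p.1, p.2, rfl⟩, q, rfl, add_comm _ _⟩
  intro p₁ h₁ p₂ h₂ a b ha hb hab
  rw [Set.mem_preimage, sectionMap_combo k q p₁ p₂ hab]
  exact (hN q ⟨h₁, hmem p₁⟩ ⟨h₂, hmem p₂⟩ ha hb hab).1

end Sectional

end RVP

/-! ### The representation of the epigraph by scalarization along `k`. -/

theorem theorem4p1 {X Y Z U : Type*}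
    [AddCommGroup X] [Module ℝ X] [TopologicalSpace X] [IsTopologicalAddGroup X]
    [ContinuousSMul ℝ X] [LocallyConvexSpace ℝ X] [T2Space X]
    [AddCommGroup Y] [Module ℝ Y] [TopologicalSpace Y] [IsTopologicalAddGroup Y]
    [ContinuousSMul ℝ Y] [LocallyConvexSpace ℝ Y] [T2Space Y]
    [AddCommGroup Z] [Module ℝ Z] [TopologicalSpace Z] [IsTopologicalAddGroup Z]
    [ContinuousSMul ℝ Z] [LocallyConvexSpace ℝ Z] [T2Space Z]
    [Nonempty U]
    (K : ConvexCone ℝ Y) (hK_closed : IsClosed (K : Set Y)) (hK_ne : (K : Set Y) ≠ Set.univ)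
    (hK_int : (interior (K : Set Y)).Nonempty)
    (S : ConvexCone ℝ Z) (hS_closed : IsClosed (S : Set Z)) (hS_nonempty : (S : Set Z).Nonempty)
    (F : X → RVP.Ext Y) (hF_proper : RVP.Proper F)
    (G : U → X → RVP.Ext Z) (hG_proper : ∀ u, RVP.Proper (G u))
    (C : Set X)
    (h_feasible : (RVP.feasible (S : Set Z) C G ∩ RVP.dom F).Nonempty)
    (hF_convex : Convex ℝ (RVP.epi (K : Set Y) F))
    (hF_lsc : RVP.PositivelyLSC (K : Set Y) F)
    (hG_convex : ∀ u, Convex ℝ (RVP.epi (S : Set Z) (G u)))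
    (hG_closed : ∀ u, IsClosed (RVP.epi (S : Set Z) (G u)))
    (hC_nonempty : C.Nonempty) (hC_closed : IsClosed C) (hC_convex : Convex ℝ C) :
    ∀ k ∈ interior (K : Set Y),
      RVP.epiConj (K : Set Y)
          (fun x => F x + RVP.indicator Y (RVP.feasible (S : Set Z) C G) x)
        = closure (RVP.sco (RVP.dirSubspace X k)
            (RVP.qualifying (K : Set Y) (S : Set Z) F C G k)) := by
  open RVP in
  intro k hk
  have hkK : k ∈ (K : Set Y) := interior_subset hk
  have hS0 := zero_mem_of_isClosed hS_closed hS_nonempty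
  have hind : ∀ (D : Set X) (v : Ext Y) (x : X), v ≠ ⊥ → v + indicator Y D x ≠ ⊥ := by
    intro D v x hv
    unfold indicator
    split_ifs <;> exact WithBot.add_ne_bot.2 ⟨hv, WithBot.coe_ne_bot⟩
  have hfeas : ∀ {x}, x ∈ feasible (S : Set Z) C G →
      x ∈ C ∧ ∀ u, ∃ g, G u x = fin g ∧ -g ∈ (S : Set Z) := by
    rintro x ⟨hxC, hx⟩
    refine ⟨hxC, fun u => ?_⟩
    obtain ⟨g, hg, hgx⟩ := Set.mem_iInter.1 hx u
    exact ⟨g, hgx.symm, hg⟩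
  obtain ⟨x₀, hx₀A, hx₀F⟩ := h_feasible
  obtain ⟨f₀, hf₀⟩ := Ext.eq_fin_of_ne (hF_proper.2 x₀) hx₀F
  have hneA : ∃ x h, F x + indicator Y (feasible (S : Set Z) C G) x = fin h :=
    ⟨x₀, f₀, add_indicator_eq_fin_iff.2 ⟨hf₀, hx₀A⟩⟩
  have hbotA : ∀ x, F x + indicator Y (feasible (S : Set Z) C G) x ≠ ⊥ :=
    fun x => hind _ _ x (hF_proper.2 x)
  have hmemA := fun q : (X →Lₚₜ[ℝ] Y) × Y =>
    mem_epiConj_iff hK_closed hk hneA hbotA (p := q)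
  have hmemB : ∀ (zs : Z →L[ℝ] ℝ) (u : U) (q : (X →Lₚₜ[ℝ] Y) × Y),
      q ∈ epiConj (K : Set Y)
        (fun x => F x + indicator Y C x + Ext.map (rankOne k zs) (G u x)) ↔
      ∀ x f g, x ∈ C → F x = fin f → G u x = fin g →
        q.1 x - (f + zs g • k) - q.2 ∉ interior (K : Set Y) := by
    intro zs u q
    rw [mem_epiConj_iff hK_closed hk]
    · constructor
      · intro h x f g hxC hf hg
        exact h x _ (add_map_eq_fin_iff.2
          ⟨f, g, add_indicator_eq_fin_iff.2 ⟨hf, hxC⟩, hg, rfl⟩)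
      · intro h x v hv
        obtain ⟨f, g, hf, hg, rfl⟩ := add_map_eq_fin_iff.1 hv
        obtain ⟨hf, hxC⟩ := add_indicator_eq_fin_iff.1 hf
        exact h x f g hxC hf hg
    · obtain ⟨g, hg, -⟩ := (hfeas hx₀A).2 u
      exact ⟨x₀, _, add_map_eq_fin_iff.2
        ⟨f₀, g, add_indicator_eq_fin_iff.2 ⟨hf₀, (hfeas hx₀A).1⟩, hg, rfl⟩⟩
    · intro x
      refine WithBot.add_ne_bot.2 ⟨hind _ _ x (hF_proper.2 x), ?_⟩
      have := (hG_proper u).2 x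
      rcases hG : G u x with _ | w
      · exact (this hG).elim
      · exact WithBot.coe_ne_bot
  apply Set.Subset.antisymm
  · rintro ⟨L, y⟩ hq
    rw [hmemA] at hq
    have hep : ∀ (x : X) (t : ℝ), (x, L x - y + t • k) ∈ epi (K : Set Y) F ↔
        ∃ f, F x = fin f ∧ L x - y + t • k - f ∈ (K : Set Y) := fun x t => mem_epi_iff
    -- Epigraph of the scalar problem on the section through `(L, y)`; its upward closure comes from
    -- `k ∈ K`.
    set P : Set (X × ℝ) := {p | p.1 ∈ C ∧ (p.1, L p.1 - y + p.2 • k) ∈ epi (K : Set Y) F} with hP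
    have hPconv : Convex ℝ P := by
      rintro ⟨x₁, t₁⟩ ⟨h₁, h₁'⟩ ⟨x₂, t₂⟩ ⟨h₂, h₂'⟩ a b ha hb hab
      refine ⟨hC_convex h₁ h₂ ha hb hab, ?_⟩
      have := hF_convex h₁' h₂' ha hb hab
      convert this using 1
      refine Prod.ext rfl ?_
      obtain rfl : a = 1 - b := by linarith
      simp only [Prod.snd_add, Prod.smul_snd, Prod.fst_add, Prod.smul_fst, map_add, map_smul,
        smul_eq_mul]
      module
    have hPcl : IsClosed P := by
      have hc : Continuous fun p : X × ℝ => ((p.1, L p.1 - y + p.2 • k) : X × Y) := by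
        have : Continuous L := ContinuousLinearMap.continuous
          ((ContinuousLinearMap.toUniformConvergenceCLM _ _ _).symm L)
        fun_prop
      exact (hC_closed.preimage continuous_fst).inter
        ((isClosed_epi_of_positivelyLSC hK_closed ⟨k, hkK⟩ hK_ne hF_proper.2 hF_lsc).preimage hc)
    have hPup : ∀ x t s, (x, t) ∈ P → t ≤ s → (x, s) ∈ P := by
      rintro x t s ⟨hxC, hx⟩ hts
      refine ⟨hxC, ?_⟩
      obtain ⟨f, hf, hm⟩ := (hep _ _).1 hx
      refine (hep _ _).2 ⟨f, hf, ?_⟩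
      have := K.add_mem hm (smul_mem_of_nonneg hK_closed hkK (sub_nonneg.2 hts))
      have e : L x - y + s • k - f = L x - y + t • k - f + (s - t) • k := by module
      exact e ▸ this
    obtain ⟨t₀, ht₀⟩ : ∃ t₀, (x₀, t₀) ∈ P := by
      obtain ⟨t, -, ht⟩ := exists_add_smul_mem_interior hk (L x₀ - y - f₀)
      refine ⟨t, (hfeas hx₀A).1, (hep _ _).2 ⟨f₀, hf₀, ?_⟩⟩
      convert interior_subset ht using 1
      abel
    have h0 : (0 : WeakDual ℝ X × ℝ) ∈ closure (convexHull ℝ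
        (lagrangeMinorants (S : Set Z) P fun u => epi (S : Set Z) (G u))) := by
      refine zero_mem_closure_convexHull_lagrangeMinorants S hPconv hPcl hPup hG_convex hG_closed
        ?_ ht₀ ?_ ?_
      · intro u x z s hs hz
        obtain ⟨g, hg, hz⟩ := mem_epi_iff.1 hz
        exact mem_epi_iff.2 ⟨g, hg, by simpa [add_sub_right_comm] using S.add_mem hz hs⟩
      · intro u
        obtain ⟨g, hg, hgS⟩ := (hfeas hx₀A).2 u
        exact mem_epi_iff.2 ⟨g, hg, by simpa using hgS⟩
      · rintro x t ⟨hxC, hx⟩ hQ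
        by_contra! ht
        obtain ⟨f, hf, hm⟩ := (hep _ _).1 hx
        have hxA : x ∈ feasible (S : Set Z) C G := by
          refine ⟨hxC, Set.mem_iInter.2 fun u => ?_⟩
          obtain ⟨g, hg, hgS⟩ := mem_epi_iff.1 (hQ u)
          exact ⟨g, by simpa using hgS, hg.symm⟩
        -- A feasible point with `t < 0` would put `L x - f - y = (-t) k + (L x - y + t k - f)` in
        -- `int K`.
        refine hq x f (add_indicator_eq_fin_iff.2 ⟨hf, hxA⟩) ?_
        have := add_mem_interior (smul_mem_interior hk (neg_pos.2 ht)) hm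
        convert this using 1
        change L x - f - y = _
        module
    have hmaps : Set.MapsTo (sectionMap k (L, y)) (convexHull ℝ
        (lagrangeMinorants (S : Set Z) P fun u => epi (S : Set Z) (G u)))
        (sco (dirSubspace X k) (qualifying (K : Set Y) (S : Set Z) F C G k)) := by
      refine convexHull_min ?_ (convex_preimage_sectionMap
        (sectionallyConvex_sco (dirSubspace X k) _) _)
      rintro ⟨a, r⟩ ⟨zs, hzs, u, h⟩
      refine subset_sco _ _ (Set.mem_iUnion₂.2 ⟨zs, hzs, Set.mem_iUnion.2 ⟨u, ?_⟩⟩)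
      rw [hmemB]
      intro x f g hxC hf hg hm
      -- Interior slack lowers the scalar value by `ε`, making it strictly smaller than the minorant
      -- allows.
      obtain ⟨ε, hε, hm'⟩ := exists_sub_smul_mem_interior k hm
      have := h x (a x - zs g - r - ε) g ⟨hxC, (hep _ _).2 ⟨f, hf, ?_⟩⟩
        (mem_epi_iff.2 ⟨g, hg, by simpa using hS0⟩)
      · change a x - r ≤ _ at this
        linarith
      · convert interior_subset hm' using 1
        change _ = L x + a x • k - (f + zs g • k) - (y + r • k) - ε • k
        module
    have := map_mem_closure (continuous_sectionMap k (L, y)) h0 hmaps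
    convert this using 1
    refine Prod.ext ?_ ?_
    · ext x
      change L x = L x + (0 : ℝ) • k
      simp
    · change y = y + (0 : ℝ) • k
      simp
  · refine closure_minimal ?_ (isClosed_epiConj hK_closed hk hneA hbotA)
    refine Set.sInter_subset_of_mem ⟨?_, sectionallyConvex_epiConj hK_closed hk hneA hbotA⟩
    intro q hq
    obtain ⟨zs, hzs, hq⟩ := Set.mem_iUnion₂.1 hq
    obtain ⟨u, hq⟩ := Set.mem_iUnion.1 hq
    rw [hmemB] at hq
    rw [hmemA]
    intro x f hf hm
    obtain ⟨hf, hxA⟩ := add_indicator_eq_fin_iff.1 hf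
    obtain ⟨hxC, hxG⟩ := hfeas hxA
    obtain ⟨g, hg, hgS⟩ := hxG u
    refine hq x f g hxC hf hg ?_
    -- `z* (-g) ≥ 0` supplies the nonnegative multiple of `k` that moves the value of `F` to that of
    -- the Lagrangian inside `int K`.
    have h1 := hzs _ hgS
    convert add_smul_mem_interior hm hk h1 using 1
    rw [map_neg]
    module
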